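/- Let $\mathbb{K}$ be a field of characteristic zero and let $\mathbb{K}[X]\langle\theta\rangle$ be the associative $\mathbb{K}$-algebra generated by $X$ and $\theta$ with the single relation $\theta X = X(\theta+1)$; every element has a unique canonical form $\sum_{i,j} a_{i,j}X^i\theta^j$ with $a_{i,j}\in\mathbb{K}$, and it has bidegree at most $(d,r)$ if $a_{i,j}=0$ unless $i\le d$ and $j\le r$. Costs are worst-case numbers of arithmetical operations $+,-,\times,\div$ in $\mathbb{K}$ (ops), in the model of algebraic computation trees over $\mathbb{K}$ (with constants of $\mathbb{K}$ and tests for zero available free of charge, and no division by zero on any input); one tree is used for each problem size. Let $\mathsf{C}_\theta,\mathsf{M}:\mathbb{N}\to\mathbb{N}$ be functions such that, for every $n\ge 0$, - the canonical form of the product of two elements of $\mathbb{K}[X]\langle\theta\rangle$ of bidegree at most $(n,n)$, given in canonical form, can be computed in $\mathsf{C}_\theta(n)$ ops; - two polynomials of degree at most $n$ in $\mathbb{K}[X]$ can be multiplied in $\mathsf{M}(n)$ ops. Assume that $\mathsf{M}$ satisfies the usual growth conditions: $\mathsf{M}(m)+\mathsf{M}(n)\le \mathsf{M}(m+n)$ for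 all $m,n\ge 1$, and $\mathsf{M}(cn)\in O(\mathsf{M}(n))$ for every positive integer constant $c$. Let $\mathsf{MM}(n)$ be the least number of ops in which two $n\times n$ matrices over $\mathbb{K}$ can be multiplied (this minimum exists). Then there exists a constant $K>0$ such that, for all $n\ge 0$, \[ \mathsf{MM}(n)\;\le\; K\bigl(\mathsf{C}_\theta(n)+n\,\mathsf{M}(n)\log n\bigr), \] where $n\,\mathsf{M}(n)\log n$ is read as $0$ for $n=0$. -/

import Mathlib

open Filter Asymptotics

/-! ### Arithmetic complexity: algebraic computation trees -/

/-- The four arithmetical operations of a field. -/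
inductive ArithOp : Type
  | add | sub | mul | div

/-- Result of an arithmetical operation; dividing by zero is an error (`none`). -/
noncomputable def ArithOp.eval {K : Type*} [Field K] : ArithOp → K → K → Option K
  | .add, a, b => some (a + b)
  | .sub, a, b => some (a - b)
  | .mul, a, b => some (a * b)
  | .div, a, b => open Classical in if b = 0 then none else some (a / b)

/-- An algebraic computation tree over `K` whose outputs are indexed by `o` and whose available
values are indexed by `ν` (at the root, these are the inputs). An operand `ν ⊕ K` is either an
available value or a constant of `K`. A node `op` performs one arithmetical operation, whose result
becomes the new available value `none : Option ν`; a node `test` branches according to whether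
its operand is zero; a leaf `ret` returns operands as the outputs. -/
inductive CompTree (K : Type*) (o : Type) : Type → Type _
  | ret {ν : Type} (out : o → ν ⊕ K) : CompTree K o ν
  | op {ν : Type} (f : ArithOp) (x y : ν ⊕ K) (next : CompTree K o (Option ν)) : CompTree K o ν
  | test {ν : Type} (x : ν ⊕ K) (ifZero ifNonzero : CompTree K o ν) : CompTree K o ν

namespace CompTree

/-- The number of arithmetical operations performed in the worst case. -/
def cost {K : Type*} {o : Type} : {ν : Type} → CompTree K o ν → ℕ
  | _, ret _ => 0
  | _, op _ _ _ next => next.cost + 1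
  | _, test _ t e => max t.cost e.cost

/-- Value of an operand, when the available values are given by `env`. -/
def operand {K : Type*} {ν : Type} (env : ν → K) (x : ν ⊕ K) : K :=
  x.elim env id

/-- Run the tree on `env`; the result is `none` if a division by zero occurs. -/
noncomputable def eval {K : Type*} [Field K] {o : Type} :
    {ν : Type} → CompTree K o ν → (ν → K) → Option (o → K)
  | _, ret out, env => some fun j => operand env (out j)
  | _, op f x y next, env =>
      (f.eval (operand env x) (operand env y)).bind fun v =>
        next.eval fun i => i.elim v env
  | _, test x t e, env =>
      open Classical in if operand env x = 0 then t.eval env else e.eval env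

end CompTree

/-- A computational problem over `K` with inputs indexed by `ι` and outputs indexed by `o`:
`P x y` says that `y` is a correct answer for the input `x`. -/
abbrev CompProblem (K : Type*) (ι o : Type) := (ι → K) → (o → K) → Prop

/-- `P` can be solved in `k` arithmetical operations in `K`: some computation tree that performs at
most `k` operations runs on every input without dividing by zero and gives a correct answer. -/
def SolvableIn {K : Type*} [Field K] {ι o : Type} (P : CompProblem K ι o) (k : ℕ) : Prop :=
  ∃ t : CompTree K o ι, t.cost ≤ k ∧ ∀ x : ι → K, ∃ y : o → K, t.eval x = some y ∧ P x y

/-! ### Polynomial multiplication -/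

/-- The polynomial `∑_{i ≤ n} a i X^i`. -/
noncomputable def polyOfCoeffs {K : Type*} [Field K] {n : ℕ} (a : Fin (n + 1) → K) :
    Polynomial K :=
  ∑ i : Fin (n + 1), Polynomial.C (a i) * Polynomial.X ^ (i : ℕ)

/-- Multiplication of two polynomials of degree at most `n`, given by their coefficients. -/
def polyMulProblem (K : Type*) [Field K] (n : ℕ) :
    CompProblem K (Fin (n + 1) ⊕ Fin (n + 1)) (Fin (2 * n + 1)) :=
  fun x y => polyOfCoeffs y =
    polyOfCoeffs (fun i => x (Sum.inl i)) * polyOfCoeffs (fun i => x (Sum.inr i))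

/-! ### Matrix multiplication -/

/-- Multiplication of an `m × n` matrix by an `n × p` matrix. -/
def matMulProblem (K : Type*) [Field K] (m n p : ℕ) :
    CompProblem K ((Fin m × Fin n) ⊕ (Fin n × Fin p)) (Fin m × Fin p) :=
  fun x y => Matrix.of (fun i j => y (i, j)) =
    Matrix.of (fun i j => x (Sum.inl (i, j))) * Matrix.of (fun i j => x (Sum.inr (i, j)))

/-- The least number of operations in `K` in which two `n × n` matrices can be multiplied. -/
noncomputable def matMulCost (K : Type*) [Field K] (n : ℕ) : ℕ :=
  sInf {k | SolvableIn (matMulProblem K n n n) k}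

/-! ### Operator multiplication in `K[X]⟨θ⟩` -/

/-- The generators of the algebra `K[X]⟨θ⟩`. -/
inductive ThetaGen : Type
  | X | theta

/-- The commutation rule `θ X = X (θ + 1)`. -/
inductive ThetaRel (K : Type*) [Field K] :
    FreeAlgebra K ThetaGen → FreeAlgebra K ThetaGen → Prop
  | comm : ThetaRel K
      (FreeAlgebra.ι K ThetaGen.theta * FreeAlgebra.ι K ThetaGen.X)
      (FreeAlgebra.ι K ThetaGen.X * (FreeAlgebra.ι K ThetaGen.theta + 1))

/-- The associative algebra `K[X]⟨θ⟩ = K⟨X, θ; θ X = X (θ + 1)⟩`. -/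
abbrev ThetaAlgebra (K : Type*) [Field K] := RingQuot (ThetaRel K)

namespace ThetaAlgebra

/-- The element `X` of `K[X]⟨θ⟩`. -/
noncomputable def X (K : Type*) [Field K] : ThetaAlgebra K :=
  RingQuot.mkAlgHom K (ThetaRel K) (FreeAlgebra.ι K ThetaGen.X)

/-- The element `θ` of `K[X]⟨θ⟩`. -/
noncomputable def theta (K : Type*) [Field K] : ThetaAlgebra K :=
  RingQuot.mkAlgHom K (ThetaRel K) (FreeAlgebra.ι K ThetaGen.theta)

/-- The operator of bidegree at most `(d, r)` with canonical form
`∑_{i ≤ d, j ≤ r} a (i, j) X^i θ^j`. -/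
noncomputable def ofCoeffs {K : Type*} [Field K] {d r : ℕ} (a : Fin (d + 1) × Fin (r + 1) → K) :
    ThetaAlgebra K :=
  ∑ i : Fin (d + 1), ∑ j : Fin (r + 1), a (i, j) • (X K ^ (i : ℕ) * theta K ^ (j : ℕ))

end ThetaAlgebra

/-- Computation of the canonical form of the product of two operators in `K[X]⟨θ⟩` of bidegree at
most `(d, r)`, given in canonical form. -/
def thetaMulProblem (K : Type*) [Field K] (d r : ℕ) :
    CompProblem K ((Fin (d + 1) × Fin (r + 1)) ⊕ (Fin (d + 1) × Fin (r + 1)))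
      (Fin (2 * d + 1) × Fin (2 * r + 1)) :=
  fun x y => ThetaAlgebra.ofCoeffs y =
    ThetaAlgebra.ofCoeffs (fun i => x (Sum.inl i)) *
      ThetaAlgebra.ofCoeffs (fun i => x (Sum.inr i))

/-! Why it holds: `theta K` acts on polynomials as X d/dX, with eigenvalue l on X^l. Hence an
operator ∑ X^d b_d(θ) sends X^l to ∑ b_d(l) X^(d+l), and its action on finitely many monomials can
be prescribed by interpolating each b_d. For m × m matrices with m a power of two and 2m ≤ n < 4m,
choose B sending X^l to ∑_q Y_{q,l} X^(m+q) for l < m, and A sending X^(m+q) to ∑_i X_{i,q}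
X^(2m+i). The coefficient of X^(2m+i) in AB X^l is then the entry (i,l) of the matrix product. The
shifts m make all exponents of X in A and B nonnegative; these exponents stay below 2m and the
degrees in θ below m, so one product of bidegree (n,n) suffices.

The conversions are interpolations of O(n) polynomials at m integers and evaluations of O(n)
polynomials of degree O(n) at m integers. Divide and conquer costs O(M(m) log m) for each
(`exists_costLe_interpolate`, `CostLe.multipointEval`); everything that depends on the points alone
is a free constant. Matrices of size n are padded to 4 × 4 blocks of size m. The core is
`MatMulCostLe.of_thetaMul`.

Costs are tracked by `CostLe`: it speaks of functions of the input, so that a subroutine with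
branching still has well-defined outputs, and of whole families computed by one tree, so that
intermediate results are shared. -/

namespace CompTree

/-! ### Composition of computation trees. -/

variable {K : Type*} {o o' : Type}

/-- Replace the available values of a tree by operands over another set of available values. -/
def subst : {μ ν : Type} → CompTree K o μ → (μ → ν ⊕ K) → CompTree K o ν
  | _, _, ret out, σ => ret fun j => (out j).elim σ Sum.inr
  | _, _, op f x y next, σ =>
      op f (x.elim σ Sum.inr) (y.elim σ Sum.inr)
        (next.subst fun i => i.elim (Sum.inl none) fun i => (σ i).map some id)
  | _, _, test x t e, σ => test (x.elim σ Sum.inr) (t.subst σ) (e.subst σ)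

theorem cost_subst {μ ν : Type} (t : CompTree K o μ) (σ : μ → ν ⊕ K) :
    (t.subst σ).cost = t.cost := by
  induction t generalizing ν with
  | ret out => rfl
  | op f x y next ih => simp [subst, cost, ih]
  | test x t e iht ihe => simp [subst, cost, iht, ihe]

theorem operand_elim {μ ν : Type} (env : ν → K) (σ : μ → ν ⊕ K) (x : μ ⊕ K) :
    operand env (x.elim σ Sum.inr) = operand (fun i => operand env (σ i)) x := by
  cases x <;> rfl

theorem eval_subst [Field K] {μ ν : Type} (t : CompTree K o μ) (σ : μ → ν ⊕ K) (env : ν → K) :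
    (t.subst σ).eval env = t.eval fun i => operand env (σ i) := by
  induction t generalizing ν with
  | ret out => simp [subst, eval, operand_elim]
  | op f x y next ih =>
    simp only [subst, eval, operand_elim, ih]
    congr 1
    funext v
    congr 1
    funext i
    cases i with
    | none => rfl
    | some i => cases h : σ i <;> simp [operand, h]
  | test x t e iht ihe =>
    simp only [subst, eval, iht, ihe]
    cases x <;> rfl

/-- Run `t`, then run `s` on operands chosen among the outputs of `t` and the initially available
values. -/
def seq : {ν : Type} → CompTree K o ν → {μ : Type} → CompTree K o' μ →
    (μ → (o ⊕ ν) ⊕ K) → CompTree K o' ν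
  | _, ret out, _, s, σ => s.subst fun i => (σ i).elim (Sum.elim out Sum.inl) Sum.inr
  | _, op f x y next, _, s, σ => op f x y (next.seq s fun i => (σ i).map (Sum.map id some) id)
  | _, test x t e, _, s, σ => test x (t.seq s σ) (e.seq s σ)

theorem cost_seq {ν μ : Type} (t : CompTree K o ν) (s : CompTree K o' μ)
    (σ : μ → (o ⊕ ν) ⊕ K) : (t.seq s σ).cost = t.cost + s.cost := by
  induction t with
  | ret out => simp [seq, cost, cost_subst]
  | op f x y next ih => simp only [seq, cost, ih]; omega
  | test x t e iht ihe => simp only [seq, cost, iht, ihe]; omega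

theorem eval_seq [Field K] {ν μ : Type} (t : CompTree K o ν) (s : CompTree K o' μ)
    (σ : μ → (o ⊕ ν) ⊕ K) (env : ν → K) :
    (t.seq s σ).eval env =
      (t.eval env).bind fun y => s.eval fun i => operand (Sum.elim y env) (σ i) := by
  induction t with
  | ret out =>
    simp only [seq, eval, eval_subst, Option.bind_some]
    congr 1
    funext i
    rcases σ i with (j | i) | c <;> rfl
  | op f x y next ih =>
    simp only [seq, eval, ih, Option.bind_assoc]
    congr 1
    funext v
    congr 1
    funext y
    congr 1
    funext i
    rcases σ i with (j | i) | c <;> rfl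
  | test x t e iht ihe =>
    simp only [seq, eval, iht, ihe]
    split <;> rfl

/-- A tree that performs no operation returns fixed operands on the inputs without zeros. -/
theorem exists_out_of_cost_eq_zero [Field K] {ν : Type} (t : CompTree K o ν) (ht : t.cost = 0) :
    ∃ out : o → ν ⊕ K, ∀ env : ν → K, (∀ i, env i ≠ 0) →
      t.eval env = some fun j => operand env (out j) := by
  induction t with
  | ret out => exact ⟨out, fun _ _ => rfl⟩
  | op f x y next ih => simp [cost] at ht
  | test x t e iht ihe =>
    simp only [cost, Nat.max_eq_zero_iff] at ht
    obtain ⟨outt, h₁⟩ := iht ht.1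
    obtain ⟨oute, h₂⟩ := ihe ht.2
    -- When no input is zero, a test on an input always takes the nonzero branch, and a test on a
    -- constant has the same outcome for all inputs.
    rcases x with i | c
    · refine ⟨oute, fun env henv => ?_⟩
      rw [eval, if_neg (show operand env (Sum.inl i) ≠ 0 from henv i), h₂ env henv]
    · by_cases hc : c = 0
      · refine ⟨outt, fun env henv => ?_⟩
        rw [eval, if_pos (show operand env (Sum.inr c) = 0 from hc), h₁ env henv]
      · refine ⟨oute, fun env henv => ?_⟩
        rw [eval, if_neg (show operand env (Sum.inr c) ≠ 0 from hc), h₂ env henv]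

end CompTree

/-- A problem one of whose outputs is the square of `u` when all inputs are equal to `u` cannot be
solved without operations. -/
theorem SolvableIn.pos_of_sq {K : Type*} [Field K] [CharZero K] {ι o : Type}
    {P : CompProblem K ι o} {k : ℕ} (h : SolvableIn P k) (j : o)
    (hP : ∀ (u : K) (y : o → K), P (fun _ => u) y → y j = u * u) : 0 < k := by
  obtain ⟨t, ht, hy⟩ := h
  rcases Nat.eq_zero_or_pos k with rfl | hk
  · exfalso
    obtain ⟨out, hout⟩ := t.exists_out_of_cost_eq_zero (Nat.le_zero.mp ht)
    have key : ∀ u : K, u ≠ 0 → CompTree.operand (fun _ => u) (out j) = u * u := by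
      intro u hu
      obtain ⟨y, h₁, h₂⟩ := hy fun _ => u
      rw [hout _ fun _ => hu, Option.some_inj] at h₁
      rw [← hP u y h₂, ← h₁]
    -- The output is either an input, which would give 2 = 4, or a constant, which would give 4 = 9.
    have h₂ := key 2 two_ne_zero
    have h₃ := key 3 three_ne_zero
    rcases hj : out j with i | c
    · rw [hj] at h₂
      simp only [CompTree.operand, Sum.elim_inl] at h₂
      norm_num at h₂
    · rw [hj] at h₂ h₃
      simp only [CompTree.operand, Sum.elim_inr, id] at h₂ h₃
      rw [h₂] at h₃
      norm_num at h₃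
  · exact hk

/-! ### Computing functions of the input -/

section CostLe

variable {K : Type*} [Field K] {E : Type*}

/-- The functions in `T` can be computed from those in `S` in at most `k` operations. -/
def CostLe (S T : Set (E → K)) (k : ℕ) : Prop :=
  ∀ (o : Type) (h : o → E → K), (∀ j, h j ∈ T) →
    ∃ (ν : Type) (g : ν → E → K), (∀ i, g i ∈ S) ∧ ∃ t : CompTree K o ν,
      t.cost ≤ k ∧ ∀ e, t.eval (fun i => g i e) = some fun j => h j e

/-- The constant functions. -/
def constFuns (K : Type*) [Field K] (E : Type*) : Set (E → K) :=
  Set.range (algebraMap K (E → K))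

namespace CostLe

variable {S S' T T' U : Set (E → K)} {k k' : ℕ}

/-- The second tree reads each operand either from the outputs of the first, when it lies in `T`, or
from the original inputs. Allowing `S ∪ T` in the second stage is what lets later computations reuse
earlier data. -/
theorem trans (h₁ : CostLe S T k) (h₂ : CostLe (S ∪ T) U k') : CostLe S U (k + k') := by
  classical
  intro o h hh
  obtain ⟨μ, g', hg', t', ht', hev'⟩ := h₂ o h hh
  obtain ⟨ν, g, hg, t, ht, hev⟩ := h₁ {i : μ // g' i ∈ T} (fun i => g' i) fun i => i.2
  refine ⟨ν ⊕ {i : μ // g' i ∈ S}, Sum.elim g fun i => g' i, ?_,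
    (t.subst fun i => Sum.inl (Sum.inl i)).seq t' fun i =>
      if hi : g' i ∈ T then Sum.inl (Sum.inl ⟨i, hi⟩)
      else Sum.inl (Sum.inr (Sum.inr ⟨i, (hg' i).resolve_right hi⟩)), ?_, fun e => ?_⟩
  · rintro (i | i)
    exacts [hg i, i.2]
  · rw [CompTree.cost_seq, CompTree.cost_subst]
    omega
  · rw [CompTree.eval_seq, CompTree.eval_subst]
    simp only [CompTree.operand, Sum.elim_inl, hev e, Option.bind_some]
    rw [← hev' e]
    congr 1
    funext i
    split <;> rfl

/-- Leaves may return inputs and constants at no cost. This is why the rules below only ask for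
membership in `S ∪ constFuns K E`. -/
theorem keep (h₁ : CostLe S T k) : CostLe S (T ∪ (S ∪ constFuns K E)) k := by
  classical
  intro o h hh
  obtain ⟨ν, g, hg, t, ht, hev⟩ := h₁ {i : o // h i ∈ T} (fun i => h i) fun i => i.2
  have hc : ∀ j, ∃ c : K, h j ∉ T → h j ∉ S → algebraMap K (E → K) c = h j := by
    intro j
    rcases hh j with hj | hj | ⟨c, hj⟩
    · exact ⟨0, fun h => absurd hj h⟩
    · exact ⟨0, fun _ h => absurd hj h⟩
    · exact ⟨c, fun _ _ => hj⟩
  choose c hc using hc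
  refine ⟨ν ⊕ {i : o // h i ∈ S}, Sum.elim g fun i => h i, ?_,
    (t.subst fun i => Sum.inl (Sum.inl i)).seq (CompTree.ret Sum.inl) fun i =>
      if hi : h i ∈ T then Sum.inl (Sum.inl ⟨i, hi⟩)
      else if hi' : h i ∈ S then Sum.inl (Sum.inr (Sum.inr ⟨i, hi'⟩))
      else Sum.inr (c i), ?_, fun e => ?_⟩
  · rintro (i | i)
    exacts [hg i, i.2]
  · rw [CompTree.cost_seq, CompTree.cost_subst]
    simpa [CompTree.cost] using ht
  · rw [CompTree.eval_seq, CompTree.eval_subst]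
    simp only [CompTree.operand, Sum.elim_inl, hev e, Option.bind_some, CompTree.eval]
    congr 1
    funext i
    split
    · rfl
    · split
      · rfl
      · rename_i h₁ h₂
        rw [← hc i h₁ h₂]
        rfl

theorem weaken (h₁ : CostLe S T k) (hT : T' ⊆ T) (hk : k ≤ k') : CostLe S T' k' := by
  intro o h hh
  obtain ⟨ν, g, hg, t, ht, hev⟩ := h₁ o h fun j => hT (hh j)
  exact ⟨ν, g, hg, t, ht.trans hk, hev⟩

theorem of_subset (hT : T ⊆ S ∪ constFuns K E) : CostLe S T k := by
  have h₀ : CostLe S (∅ : Set (E → K)) 0 := by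
    intro o h hh
    exact ⟨PEmpty, fun i => i.elim, fun i => i.elim, CompTree.ret fun j => (hh j).elim, le_rfl,
      fun e => by simp only [CompTree.eval]; congr 1; funext j; exact (hh j).elim⟩
  exact h₀.keep.weaken (fun x hx => Or.inr (hT hx)) (Nat.zero_le k)

theorem mono (h₁ : CostLe S T k) (hS : S ⊆ S' ∪ constFuns K E)
    (hT : T' ⊆ T ∪ (S' ∪ constFuns K E)) (hk : k ≤ k') : CostLe S' T' k' := by
  have h₂ : CostLe S' T k := by
    have h₃ : CostLe (S' ∪ S) T k := by
      intro o h hh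
      obtain ⟨ν, g, hg, t, ht, hev⟩ := h₁ o h hh
      exact ⟨ν, g, fun i => Or.inr (hg i), t, ht, hev⟩
    simpa using (of_subset (k := 0) hS).trans h₃
  exact h₂.keep.weaken hT hk

theorem mono_left (h₁ : CostLe S T k) (hS : S ⊆ S' ∪ constFuns K E) : CostLe S' T k :=
  h₁.mono hS Set.subset_union_left le_rfl

theorem mono_cost (h₁ : CostLe S T k) (hk : k ≤ k') : CostLe S T k' :=
  h₁.weaken subset_rfl hk

/-- Compute `T`, then `U` from what is known by then. -/
theorem trans_union (h₁ : CostLe S T k) (h₂ : CostLe (S ∪ T) U k') :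
    CostLe S (T ∪ U) (k + k') :=
  h₁.trans (h₂.mono Set.subset_union_left
    (Set.union_subset (fun _ hx => Or.inr (Or.inl (Or.inr hx))) Set.subset_union_left) le_rfl)

theorem union (h₁ : CostLe S T k) (h₂ : CostLe S U k') : CostLe S (T ∪ U) (k + k') :=
  h₁.trans_union (h₂.mono_left fun _ hx => Or.inl (Or.inl hx))

theorem biUnion {ι : Type*} (s : Finset ι) {T : ι → Set (E → K)} {k : ℕ}
    (h : ∀ i ∈ s, CostLe S (T i) k) : CostLe S (⋃ i ∈ s, T i) (s.card * k) := by
  classical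
  induction s using Finset.induction_on with
  | empty => exact of_subset (by simp)
  | insert a s ha ih =>
    rw [Finset.set_biUnion_insert, Finset.card_insert_of_notMem ha]
    refine ((h a (Finset.mem_insert_self a s)).union
      (ih fun i hi => h i (Finset.mem_insert_of_mem hi))).mono_cost (le_of_eq (by ring))

theorem iUnion {ι : Type*} [Fintype ι] {T : ι → Set (E → K)} {k : ℕ}
    (h : ∀ i, CostLe S (T i) k) : CostLe S (⋃ i, T i) (Fintype.card ι * k) := by
  simpa using biUnion Finset.univ fun i _ => h i

theorem range {ι : Type*} [Fintype ι] {T : ι → E → K} {k : ℕ}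
    (h : ∀ i, CostLe S {T i} k) : CostLe S (Set.range T) (Fintype.card ι * k) := by
  rw [← Set.iUnion_singleton_eq_range]
  exact iUnion h

/-- One arithmetical operation. -/
theorem arithOp (f : ArithOp) (a b c : E → K) (hf : ∀ e, f.eval (a e) (b e) = some (c e)) :
    CostLe {a, b} {c} 1 := by
  intro o h hh
  refine ⟨Bool, fun i => cond i a b, ?_,
    CompTree.op f (Sum.inl true) (Sum.inl false) (CompTree.ret fun _ => Sum.inl none), le_rfl,
    fun e => ?_⟩
  · rintro (_ | _) <;> simp
  · simp only [CompTree.eval, CompTree.operand, Sum.elim_inl, cond_true, cond_false, hf,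
      Option.bind_some, Option.elim]
    congr 1
    funext j
    rw [hh j]

theorem add {a b : E → K} (ha : a ∈ S ∪ constFuns K E) (hb : b ∈ S ∪ constFuns K E) :
    CostLe S {a + b} 1 :=
  (arithOp .add a b (a + b) fun _ => rfl).mono_left
    (Set.insert_subset ha (Set.singleton_subset_iff.mpr hb))

theorem sub {a b : E → K} (ha : a ∈ S ∪ constFuns K E) (hb : b ∈ S ∪ constFuns K E) :
    CostLe S {a - b} 1 :=
  (arithOp .sub a b (a - b) fun _ => rfl).mono_left
    (Set.insert_subset ha (Set.singleton_subset_iff.mpr hb))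

theorem mul {a b : E → K} (ha : a ∈ S ∪ constFuns K E) (hb : b ∈ S ∪ constFuns K E) :
    CostLe S {a * b} 1 :=
  (arithOp .mul a b (a * b) fun _ => rfl).mono_left
    (Set.insert_subset ha (Set.singleton_subset_iff.mpr hb))

theorem sum {ι : Type*} (s : Finset ι) {a : ι → E → K}
    (ha : ∀ i ∈ s, a i ∈ S ∪ constFuns K E) : CostLe S {∑ i ∈ s, a i} s.card := by
  classical
  induction s using Finset.induction_on with
  | empty => exact of_subset (by simpa using Or.inr ⟨0, map_zero _⟩)
  | insert x s hx ih =>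
    rw [Finset.sum_insert hx, Finset.card_insert_of_notMem hx]
    refine (ih fun i hi => ha i (Finset.mem_insert_of_mem hi)).trans (add ?_ (Or.inl (Or.inr rfl)))
    rcases ha x (Finset.mem_insert_self x s) with h | h
    exacts [Or.inl (Or.inl h), Or.inr h]

end CostLe

/-- Use a solution of a problem as a subroutine. -/
theorem SolvableIn.exists_costLe {ι o : Type} {P : CompProblem K ι o} {k : ℕ}
    (h : SolvableIn P k) (x : ι → E → K) :
    ∃ y : o → E → K, CostLe (Set.range x) (Set.range y) k ∧
      ∀ e, P (fun i => x i e) fun j => y j e := by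
  obtain ⟨t, ht, hev⟩ := h
  -- A tree is deterministic, so its answer is a function `F` of the input, even where the problem
  -- admits several answers.
  choose F hF hP using hev
  refine ⟨fun j e => F (fun i => x i e) j, ?_, fun e => hP _⟩
  intro o' h hh
  choose σ hσ using hh
  refine ⟨ι, x, fun i => ⟨i, rfl⟩, t.seq (CompTree.ret Sum.inl) fun j => Sum.inl (Sum.inl (σ j)),
    ?_, fun e => ?_⟩
  · simpa [CompTree.cost_seq, CompTree.cost] using ht
  · rw [CompTree.eval_seq, hF]
    simp only [Option.bind_some, CompTree.eval, CompTree.operand, Sum.elim_inl]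
    congr 1
    funext j
    rw [← hσ j]

theorem solvableIn_of_costLe {ι o : Type} {P : CompProblem K ι o} {k : ℕ}
    (y : o → (ι → K) → K)
    (h : CostLe (Set.range fun (i : ι) (e : ι → K) => e i) (Set.range y) k)
    (hP : ∀ e, P e fun j => y j e) : SolvableIn P k := by
  obtain ⟨ν, g, hg, t, ht, hev⟩ := h o y fun j => ⟨j, rfl⟩
  choose σ hσ using hg
  refine ⟨t.subst fun i => Sum.inl (σ i), by rwa [CompTree.cost_subst], fun e => ?_⟩
  refine ⟨fun j => y j e, ?_, hP e⟩
  rw [CompTree.eval_subst, ← hev e]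
  congr 1
  funext i
  rw [← hσ i]
  rfl

end CostLe

/-! ### Polynomials -/

section Polynomials

open Polynomial

variable {K : Type*} [Field K] {E : Type*}

theorem coeff_polyOfCoeffs {n : ℕ} (a : Fin (n + 1) → K) (j : ℕ) :
    (polyOfCoeffs a).coeff j = if h : j < n + 1 then a ⟨j, h⟩ else 0 := by
  simp only [polyOfCoeffs, finsetSum_coeff, coeff_C_mul, coeff_X_pow, mul_ite, mul_one, mul_zero]
  split
  · rename_i h
    rw [Finset.sum_eq_single ⟨j, h⟩]
    · simp
    · intro b _ hb
      rw [if_neg]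
      rintro rfl
      exact hb rfl
    · simp
  · rename_i h
    refine Finset.sum_eq_zero fun i _ => if_neg ?_
    have := i.2
    omega

theorem polyOfCoeffs_coeff {n : ℕ} {f : (E → K)[X]} (hf : f.natDegree ≤ n) (e : E) :
    polyOfCoeffs (fun i : Fin (n + 1) => f.coeff i e) = f.map (Pi.evalRingHom (fun _ => K) e) := by
  ext j
  rw [coeff_polyOfCoeffs, coeff_map]
  split
  · rfl
  · rw [coeff_eq_zero_of_natDegree_lt (by omega), map_zero]

/-- The set of the coefficients of a polynomial. -/
def coeffSet (f : (E → K)[X]) : Set (E → K) := Set.range f.coeff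

theorem coeffSet_map_subset (f : K[X]) :
    coeffSet (f.map (algebraMap K (E → K))) ⊆ constFuns K E := by
  rintro _ ⟨i, rfl⟩
  exact ⟨f.coeff i, by rw [coeff_map]⟩

theorem CostLe.polyMul {n k : ℕ} (h : SolvableIn (polyMulProblem K n) k) {f g : (E → K)[X]}
    (hf : f.natDegree ≤ n) (hg : g.natDegree ≤ n) :
    CostLe (coeffSet f ∪ coeffSet g) (coeffSet (f * g)) k := by
  obtain ⟨y, hy, hP⟩ := h.exists_costLe
    (Sum.elim (fun i : Fin (n + 1) => f.coeff i) fun i : Fin (n + 1) => g.coeff i)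
  refine hy.mono ?_ ?_ le_rfl
  · rintro _ ⟨i | i, rfl⟩
    exacts [Or.inl (Or.inl ⟨i, rfl⟩), Or.inl (Or.inr ⟨i, rfl⟩)]
  · have key : ∀ j, (f * g).coeff j = if h : j < 2 * n + 1 then y ⟨j, h⟩ else 0 := by
      intro j
      funext e
      have h₁ := hP e
      simp only [polyMulProblem, Sum.elim_inl, Sum.elim_inr, polyOfCoeffs_coeff hf,
        polyOfCoeffs_coeff hg, ← Polynomial.map_mul] at h₁
      have h₂ := congrArg (fun q => q.coeff j) h₁
      simp only [coeff_polyOfCoeffs, coeff_map, Pi.evalRingHom_apply] at h₂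
      rw [← h₂]
      split <;> rfl
    rintro _ ⟨j, rfl⟩
    rw [key]
    split
    · exact Or.inl ⟨_, rfl⟩
    · exact Or.inr (Or.inr ⟨0, map_zero _⟩)

theorem SolvableIn.polyMul_pos [CharZero K] {n k : ℕ} (h : SolvableIn (polyMulProblem K n) k) :
    0 < k := by
  refine h.pos_of_sq ⟨0, by omega⟩ fun u y hy => ?_
  have := congrArg (fun q => q.coeff 0) hy
  simpa [mul_coeff_zero, coeff_polyOfCoeffs] using this

theorem degree_mul_lt {R : Type*} [CommRing R] {f g : R[X]} {a b : ℕ} (hf : f.degree < a)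
    (hg : g.degree ≤ b) : (f * g).degree < ((a + b : ℕ) : WithBot ℕ) := by
  rcases eq_or_ne f 0 with rfl | hf0
  · simp
  · have h₁ : f.natDegree < a := (natDegree_lt_iff_degree_lt hf0).mpr hf
    have h₂ : g.natDegree ≤ b := natDegree_le_iff_degree_le.mpr hg
    refine lt_of_le_of_lt (degree_le_natDegree.trans (WithBot.coe_le_coe.mpr natDegree_mul_le)) ?_
    exact WithBot.coe_lt_coe.mpr (Nat.add_lt_add_of_lt_of_le h₁ h₂)

theorem natDegree_le_of_degree_lt {R : Type*} [CommRing R] {f : R[X]} {a : ℕ}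
    (hf : f.degree < a) : f.natDegree ≤ a :=
  natDegree_le_iff_degree_le.mpr hf.le

/-- Cut a polynomial at `X ^ s`. -/
theorem exists_eq_mul_X_pow_add (f : (E → K)[X]) (s : ℕ) {N : ℕ}
    (hf : f.degree < ((N + s : ℕ) : WithBot ℕ)) :
    ∃ g h : (E → K)[X], f = g * X ^ s + h ∧ g.degree < N ∧ h.degree < s ∧
      coeffSet g ⊆ coeffSet f ∪ constFuns K E ∧ coeffSet h ⊆ coeffSet f ∪ constFuns K E := by
  have hg : ∀ i, (∑ l ∈ Finset.range N, monomial l (f.coeff (l + s))).coeff i =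
      if i < N then f.coeff (i + s) else 0 := by
    intro i
    simp [coeff_monomial]
  have hh : ∀ i, (∑ l ∈ Finset.range s, monomial l (f.coeff l)).coeff i =
      if i < s then f.coeff i else 0 := by
    intro i
    simp [coeff_monomial]
  refine ⟨∑ l ∈ Finset.range N, monomial l (f.coeff (l + s)),
    ∑ l ∈ Finset.range s, monomial l (f.coeff l), ?_, ?_, ?_, ?_, ?_⟩
  · ext1 i
    rw [coeff_add, coeff_mul_X_pow', hg, hh]
    rw [degree_lt_iff_coeff_zero] at hf
    by_cases h₁ : s ≤ i
    · by_cases h₂ : i - s < N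
      · rw [if_pos h₁, if_pos h₂, if_neg (by omega), Nat.sub_add_cancel h₁, add_zero]
      · rw [if_pos h₁, if_neg h₂, if_neg (by omega), hf i (by omega), add_zero]
    · rw [if_neg h₁, if_pos (by omega), zero_add]
  · rw [degree_lt_iff_coeff_zero]
    intro i hi
    rw [hg, if_neg (by omega)]
  · rw [degree_lt_iff_coeff_zero]
    intro i hi
    rw [hh, if_neg (by omega)]
  · rintro _ ⟨i, rfl⟩
    rw [hg]
    split
    exacts [Or.inl ⟨_, rfl⟩, Or.inr ⟨0, map_zero _⟩]
  · rintro _ ⟨i, rfl⟩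
    rw [hh]
    split
    exacts [Or.inl ⟨_, rfl⟩, Or.inr ⟨0, map_zero _⟩]

theorem CostLe.coeffSet_of_coeff {S : Set (E → K)} {f : (E → K)[X]} {N : ℕ} (hf : f.degree < N)
    (h : ∀ i < N, CostLe S {f.coeff i} 1) : CostLe S (coeffSet f) N := by
  refine (CostLe.biUnion (Finset.range N) (T := fun i => {f.coeff i})
    fun i hi => h i (Finset.mem_range.mp hi)).mono Set.subset_union_left ?_ (by simp)
  rintro _ ⟨i, rfl⟩
  by_cases hi : i < N
  · exact Or.inl (Set.mem_biUnion (by simpa using hi) rfl)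
  · rw [degree_lt_iff_coeff_zero] at hf
    rw [hf i (by omega)]
    exact Or.inr (Or.inr ⟨0, map_zero _⟩)

theorem CostLe.polyAdd {S : Set (E → K)} {f g : (E → K)[X]} {N : ℕ} (hf : (f + g).degree < N)
    (hfS : coeffSet f ⊆ S ∪ constFuns K E) (hgS : coeffSet g ⊆ S ∪ constFuns K E) :
    CostLe S (coeffSet (f + g)) N :=
  coeffSet_of_coeff hf fun i _ => by
    rw [coeff_add]
    exact CostLe.add (hfS ⟨i, rfl⟩) (hgS ⟨i, rfl⟩)

theorem CostLe.polySub {S : Set (E → K)} {f g : (E → K)[X]} {N : ℕ} (hf : (f - g).degree < N)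
    (hfS : coeffSet f ⊆ S ∪ constFuns K E) (hgS : coeffSet g ⊆ S ∪ constFuns K E) :
    CostLe S (coeffSet (f - g)) N :=
  coeffSet_of_coeff hf fun i _ => by
    rw [coeff_sub]
    exact CostLe.sub (hfS ⟨i, rfl⟩) (hgS ⟨i, rfl⟩)

/-- Reduction modulo a fixed monic polynomial, with precomputed quotient of `X ^ (2 * s)`. -/
theorem exists_costLe_reduce {s k : ℕ} (h : SolvableIn (polyMulProblem K s) k) {P : K[X]}
    (hP : P.Monic) (hs : P.natDegree = s) {f : (E → K)[X]}
    (hf : f.degree < ((s + s : ℕ) : WithBot ℕ)) :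
    ∃ q : (E → K)[X], (f - q * P.map (algebraMap K (E → K))).degree < s ∧
      CostLe (coeffSet f) (coeffSet (f - q * P.map (algebraMap K (E → K)))) (2 * k + s) := by
  set φ := algebraMap K (E → K)
  have hPdeg : P.degree = s := by rw [degree_eq_natDegree hP.ne_zero, hs]
  set I := (X ^ (s + s) : K[X]) /ₘ P with hI
  set R := (X ^ (s + s) : K[X]) %ₘ P with hR
  have hIR : (X ^ (s + s) : (E → K)[X]) = R.map φ + P.map φ * I.map φ := by
    have := congrArg (Polynomial.map φ) (modByMonic_add_div (X ^ (s + s) : K[X]) P)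
    simpa using this.symm
  have hRdeg : (R.map φ).degree ≤ s :=
    degree_map_le.trans ((degree_modByMonic_lt _ hP).le.trans hPdeg.le)
  have hIdeg : (I.map φ).degree ≤ s := by
    refine degree_map_le.trans (degree_le_of_natDegree_le ?_)
    rw [hI, natDegree_divByMonic _ hP, natDegree_X_pow, hs]
    omega
  have hPdeg' : (P.map φ).degree ≤ s := degree_map_le.trans hPdeg.le
  -- Since `I` approximates X^(2s)/P, the top part `q` of f₁ I approximates f/P. This takes one
  -- multiplication, and q P takes another.
  obtain ⟨f₁, f₀, hf₁₀, hf₁, hf₀, hcf₁, -⟩ := exists_eq_mul_X_pow_add f s hf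
  obtain ⟨q, r, hqr, hq, hr, hcq, -⟩ := exists_eq_mul_X_pow_add (f₁ * I.map φ) s (degree_mul_lt hf₁ hIdeg)
  have hdeg : (f - q * P.map φ).degree < s := by
    -- After multiplication by X^s the error splits into three products, each of degree below 2s.
    have h₁ : (f - q * P.map φ) * X ^ s = f₀ * X ^ s + f₁ * R.map φ + r * P.map φ := by
      have h₂ : f * X ^ s = f₁ * (R.map φ + P.map φ * I.map φ) + f₀ * X ^ s := by
        rw [← hIR, hf₁₀]
        ring
      have h₃ : q * X ^ s = f₁ * I.map φ - r := by rw [hqr]; ring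
      calc (f - q * P.map φ) * X ^ s = f * X ^ s - (q * X ^ s) * P.map φ := by ring
        _ = _ := by rw [h₂, h₃]; ring
    have h₂ : ((f - q * P.map φ) * X ^ s).degree < ((s + s : ℕ) : WithBot ℕ) := by
      rw [h₁]
      refine (degree_add_le _ _).trans_lt (max_lt ((degree_add_le _ _).trans_lt (max_lt ?_ ?_)) ?_)
      · exact degree_mul_lt hf₀ (degree_X_pow_le s)
      · exact degree_mul_lt hf₁ hRdeg
      · exact degree_mul_lt hr hPdeg'
    rw [degree_lt_iff_coeff_zero] at h₂ ⊢
    intro i hi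
    rw [← coeff_mul_X_pow _ s]
    exact h₂ _ (by omega)
  refine ⟨q, hdeg, ?_⟩
  have c₁ : CostLe (coeffSet f) (coeffSet (f₁ * I.map φ)) k :=
    (CostLe.polyMul h (natDegree_le_of_degree_lt hf₁)
      (natDegree_le_iff_degree_le.mpr hIdeg)).mono_left
      (Set.union_subset hcf₁ ((coeffSet_map_subset I).trans Set.subset_union_right))
  have c₂ : CostLe (coeffSet f ∪ coeffSet (f₁ * I.map φ)) (coeffSet (q * P.map φ)) k :=
    (CostLe.polyMul h (natDegree_le_of_degree_lt hq)
      (natDegree_le_iff_degree_le.mpr hPdeg')).mono_left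
      (Set.union_subset (hcq.trans (Set.union_subset_union_left _ Set.subset_union_right))
        ((coeffSet_map_subset P).trans Set.subset_union_right))
  have c₃ : CostLe (coeffSet f ∪ coeffSet (q * P.map φ)) (coeffSet (f - q * P.map φ)) s :=
    CostLe.polySub hdeg (fun _ hx => Or.inl (Or.inl hx)) fun _ hx => Or.inl (Or.inr hx)
  exact ((c₁.trans c₂).trans c₃).mono_cost (by omega)

/-! ### Growth of M, fast evaluation and interpolation. -/

/-- M(1) ≥ 1 because a product cannot be formed without operations; superadditivity does the rest.
This absorbs linear costs into M. -/
theorem SolvableIn.le_polyMul [CharZero K] {M : ℕ → ℕ}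
    (hM : ∀ n, SolvableIn (polyMulProblem K n) (M n))
    (hsup : ∀ m n, 0 < m → 0 < n → M m + M n ≤ M (m + n)) (n : ℕ) : n ≤ M n := by
  induction n with
  | zero => exact Nat.zero_le _
  | succ n ih =>
    have h₁ := (hM 1).polyMul_pos
    rcases Nat.eq_zero_or_pos n with rfl | hn
    · exact h₁
    · have := hsup n 1 hn one_pos
      omega

theorem le_of_superadditive {M : ℕ → ℕ}
    (hsup : ∀ m n, 0 < m → 0 < n → M m + M n ≤ M (m + n)) {m n : ℕ} (hm : 0 < m)
    (hmn : m ≤ n) : M m ≤ M n := by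
  rcases hmn.eq_or_lt with rfl | h
  · exact le_rfl
  · have := hsup m (n - m) hm (by omega)
    rw [Nat.add_sub_cancel' hmn] at this
    omega

theorem eval_map_const (P : K[X]) (c : K) :
    (P.map (algebraMap K (E → K))).eval (algebraMap K (E → K) c) =
      algebraMap K (E → K) (P.eval c) := by
  rw [eval_map, eval₂_at_apply]

/-- The induction step for the bound 4 j M(2^j): two half-size calls plus the work of splitting or
recombining. It rests on 2 M(2^j) ≤ M(2^(j+1)) and 2^j ≤ M(2^j). -/
theorem two_pow_step {M : ℕ → ℕ} (hsup : ∀ m n, 0 < m → 0 < n → M m + M n ≤ M (m + n))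
    (hle : ∀ n, n ≤ M n) (j : ℕ) :
    4 * M (2 ^ j) + 4 * 2 ^ j + 2 * (4 * j * M (2 ^ j)) ≤ 4 * (j + 1) * M (2 ^ (j + 1)) := by
  have h₁ : 2 * M (2 ^ j) ≤ M (2 ^ (j + 1)) := by
    have := hsup (2 ^ j) (2 ^ j) (by positivity) (by positivity)
    rw [pow_succ, mul_two]
    omega
  have h₂ := hle (2 ^ j)
  have h₃ : 4 * j * (2 * M (2 ^ j)) ≤ 4 * j * M (2 ^ (j + 1)) := Nat.mul_le_mul_left _ h₁
  linarith

/-- Evaluation at consecutive members of a fixed sequence of points. -/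
theorem CostLe.multipointEval {M : ℕ → ℕ}
    (hM : ∀ n, SolvableIn (polyMulProblem K n) (M n))
    (hsup : ∀ m n, 0 < m → 0 < n → M m + M n ≤ M (m + n)) (hle : ∀ n, n ≤ M n)
    (p : ℕ → K) (j a : ℕ) (f : (E → K)[X]) (hf : f.degree < ((2 ^ j : ℕ) : WithBot ℕ)) :
    CostLe (coeffSet f)
      ((fun l => f.eval (algebraMap K (E → K) (p l))) '' Set.Ico a (a + 2 ^ j))
      (4 * j * M (2 ^ j)) := by
  induction j generalizing a f with
  | zero =>
    refine CostLe.of_subset ?_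
    rintro _ ⟨l, -, rfl⟩
    have : f = C (f.coeff 0) := by
      ext1 i
      rw [coeff_C]
      split
      · simp [*]
      · exact degree_lt_iff_coeff_zero f _ |>.mp hf i (by simp; omega)
    simp only
    rw [this, eval_C]
    exact Or.inl ⟨0, by simp⟩
  | succ j ih =>
    have hf' : f.degree < ((2 ^ j + 2 ^ j : ℕ) : WithBot ℕ) := by rwa [pow_succ, mul_two] at hf
    have half : ∀ b, CostLe (coeffSet f)
        ((fun l => f.eval (algebraMap K (E → K) (p l))) '' Set.Ico b (b + 2 ^ j))
        ((2 * M (2 ^ j) + 2 ^ j) + 4 * j * M (2 ^ j)) := by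
      intro b
      -- Reduction modulo the polynomial vanishing at the points of one half preserves the values
      -- there and halves the degree bound. That modulus depends on the points only, so it is free.
      obtain ⟨q, hq, hcost⟩ := exists_costLe_reduce (hM (2 ^ j))
        (P := Lagrange.nodal (Finset.Ico b (b + 2 ^ j)) p) Lagrange.nodal_monic
        (by simp [Lagrange.natDegree_nodal]) hf'
      refine hcost.trans ((ih b _ hq).mono (fun _ hx => Or.inl (Or.inr hx)) ?_ le_rfl)
      rintro _ ⟨l, hl, rfl⟩
      refine Or.inl ⟨l, hl, ?_⟩
      simp only [eval_sub, eval_mul, eval_map_const]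
      rw [Lagrange.eval_nodal_at_node (by simpa using hl), map_zero, mul_zero, sub_zero]
    refine ((half a).union (half (a + 2 ^ j))).weaken ?_
      (le_trans ?_ (two_pow_step hsup hle j))
    · rw [← Set.image_union, Set.Ico_union_Ico_eq_Ico (Nat.le_add_right _ _) (Nat.le_add_right _ _), pow_succ, mul_two,
        add_assoc]
    · have : 2 ^ j ≤ 4 * 2 ^ j := by omega
      linarith

/-- Evaluation of a polynomial of larger degree, cut into pieces. -/
theorem CostLe.multipointEval_of_degree_lt_mul {M : ℕ → ℕ}
    (hM : ∀ n, SolvableIn (polyMulProblem K n) (M n))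
    (hsup : ∀ m n, 0 < m → 0 < n → M m + M n ≤ M (m + n)) (hle : ∀ n, n ≤ M n)
    (p : ℕ → K) (j a b : ℕ) (f : (E → K)[X]) (hf : f.degree < ((b * 2 ^ j : ℕ) : WithBot ℕ)) :
    CostLe (coeffSet f)
      ((fun l => f.eval (algebraMap K (E → K) (p l))) '' Set.Ico a (a + 2 ^ j))
      (b * (4 * j * M (2 ^ j) + 2 * 2 ^ j)) := by
  induction b generalizing f with
  | zero =>
    refine CostLe.of_subset ?_
    rintro _ ⟨l, -, rfl⟩
    have : f = 0 := by
      ext1 i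
      exact degree_lt_iff_coeff_zero f _ |>.mp hf i (by simp)
    exact Or.inr ⟨0, by simp [this]⟩
  | succ b ih =>
    obtain ⟨g, h, hgh, hg, hh, hcg, hch⟩ :=
      exists_eq_mul_X_pow_add f (2 ^ j) (N := b * 2 ^ j) (by rwa [add_mul, one_mul] at hf)
    set ev : (E → K)[X] → ℕ → (E → K) := fun f l => f.eval (algebraMap K (E → K) (p l)) with hev
    have c₁ : CostLe (coeffSet f) (ev g '' Set.Ico a (a + 2 ^ j)) _ := (ih g hg).mono_left hcg
    have c₂ : CostLe (coeffSet f) (ev h '' Set.Ico a (a + 2 ^ j)) _ :=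
      (CostLe.multipointEval hM hsup hle p j a h hh).mono_left hch
    have c₃ : CostLe (ev g '' Set.Ico a (a + 2 ^ j) ∪ ev h '' Set.Ico a (a + 2 ^ j))
        (ev f '' Set.Ico a (a + 2 ^ j)) (2 * 2 ^ j) := by
      refine (CostLe.biUnion (Finset.Ico a (a + 2 ^ j)) (T := fun l => {ev f l}) (k := 2)
        fun l hl => ?_).weaken ?_ (by simp [mul_comm])
      · have hl' : l ∈ Set.Ico a (a + 2 ^ j) := by simpa using hl
        -- A Horner step in X^(2^j); the powers of the points are constants, so each point costs two
        -- operations.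
        have h₁ : ev f l = ev g l * algebraMap K (E → K) (p l ^ 2 ^ j) + ev h l := by
          simp only [hev, map_pow]
          conv_lhs => rw [hgh]
          simp
        rw [h₁]
        exact (CostLe.mul (Or.inl (Or.inl ⟨l, hl', rfl⟩)) (Or.inr ⟨_, rfl⟩)).trans
          (CostLe.add (Or.inl (Or.inr rfl)) (Or.inl (Or.inl (Or.inr ⟨l, hl', rfl⟩))))
      · rintro _ ⟨l, hl, rfl⟩
        exact Set.mem_biUnion (by simpa using hl) rfl
    refine ((c₁.union c₂).trans (c₃.mono_left fun _ hx => Or.inl (Or.inr hx))).mono_cost ?_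
    linarith

/-- Interpolation at consecutive members of a fixed sequence of points. -/
theorem exists_costLe_interpolate {M : ℕ → ℕ}
    (hM : ∀ n, SolvableIn (polyMulProblem K n) (M n))
    (hsup : ∀ m n, 0 < m → 0 < n → M m + M n ≤ M (m + n)) (hle : ∀ n, n ≤ M n)
    {p : ℕ → K} (hp : Function.Injective p) (j a : ℕ) (v : ℕ → E → K) :
    ∃ f : (E → K)[X], f.degree < ((2 ^ j : ℕ) : WithBot ℕ) ∧
      (∀ l ∈ Set.Ico a (a + 2 ^ j), f.eval (algebraMap K (E → K) (p l)) = v l) ∧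
      CostLe (v '' Set.Ico a (a + 2 ^ j)) (coeffSet f) (4 * j * M (2 ^ j)) := by
  induction j generalizing a v with
  | zero =>
    refine ⟨C (v a), degree_C_le.trans_lt (by simp), fun l hl => ?_, CostLe.of_subset ?_⟩
    · obtain rfl : l = a := by rw [Set.mem_Ico] at hl; omega
      simp
    · rintro _ ⟨i, rfl⟩
      rw [coeff_C]
      split
      · exact Or.inl ⟨a, by simp, rfl⟩
      · exact Or.inr ⟨0, map_zero _⟩
  | succ j ih =>
    set φ := algebraMap K (E → K) with hφ
    set s := 2 ^ j with hs
    -- An interpolant on one half is multiplied by the polynomial vanishing on the other half, so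
    -- the two contributions can be added. The values are divided beforehand by those of this
    -- factor, which are nonzero constants because `p` is injective.
    have half : ∀ b c, (∀ l ∈ Set.Ico b (b + s), l ∉ Set.Ico c (c + s)) →
        ∃ f : (E → K)[X], f.degree < (s : WithBot ℕ) ∧
          (∀ l ∈ Set.Ico b (b + s), (f * (Lagrange.nodal (Finset.Ico c (c + s)) p).map φ).eval
            (φ (p l)) = v l) ∧
          (∀ l ∈ Set.Ico c (c + s), (f * (Lagrange.nodal (Finset.Ico c (c + s)) p).map φ).eval
            (φ (p l)) = 0) ∧
          (f * (Lagrange.nodal (Finset.Ico c (c + s)) p).map φ).degree <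
            ((s + s : ℕ) : WithBot ℕ) ∧
          CostLe (v '' Set.Ico b (b + s))
            (coeffSet (f * (Lagrange.nodal (Finset.Ico c (c + s)) p).map φ))
            (s + 4 * j * M s + M s) := by
      intro b c hbc
      set P := Lagrange.nodal (Finset.Ico c (c + s)) p with hP
      have hPdeg : (P.map φ).degree ≤ s := by
        refine degree_map_le.trans ?_
        rw [hP, Lagrange.degree_nodal]
        simp
      obtain ⟨f, hf, hfv, hc⟩ := ih b fun l => v l * φ (P.eval (p l))⁻¹
      refine ⟨f, hf, fun l hl => ?_, fun l hl => ?_, degree_mul_lt hf hPdeg, ?_⟩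
      · rw [eval_mul, eval_map_const, hfv l hl, mul_assoc, ← map_mul, inv_mul_cancel₀,
          map_one, mul_one]
        refine Lagrange.eval_nodal_not_at_node fun i hi => ?_
        intro h
        exact hbc l hl (by rw [hp h]; simpa using hi)
      · rw [eval_mul, eval_map_const, hP,
          Lagrange.eval_nodal_at_node (by simpa using hl), map_zero, mul_zero]
      · have c₁ : CostLe (v '' Set.Ico b (b + s))
            ((fun l => v l * φ (P.eval (p l))⁻¹) '' Set.Ico b (b + s)) s := by
          refine (CostLe.biUnion (Finset.Ico b (b + s))
            (T := fun l => {v l * φ (P.eval (p l))⁻¹}) (k := 1)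
            fun l hl => ?_).weaken ?_ (by simp)
          · exact CostLe.mul (Or.inl ⟨l, by simpa using hl, rfl⟩) (Or.inr ⟨_, rfl⟩)
          · rintro _ ⟨l, hl, rfl⟩
            exact Set.mem_biUnion (by simpa using hl) rfl
        have c₂ : CostLe (coeffSet f) (coeffSet (f * P.map φ)) (M s) :=
          (CostLe.polyMul (hM s) (natDegree_le_of_degree_lt hf)
            (natDegree_le_iff_degree_le.mpr hPdeg)).mono_left
            (Set.union_subset_union_right _ (coeffSet_map_subset P))
        exact (c₁.trans (hc.mono_left fun _ hx => Or.inl (Or.inr hx))).trans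
          (c₂.mono_left fun _ hx => Or.inl (Or.inr hx))
    have hspos : 0 < s := by positivity
    obtain ⟨f₀, -, h₀, h₀', hd₀, hc₀⟩ := half a (a + s) (by simp only [Set.mem_Ico]; omega)
    obtain ⟨f₁, -, h₁, h₁', hd₁, hc₁⟩ := half (a + s) a (by simp only [Set.mem_Ico]; omega)
    have h2s : 2 ^ (j + 1) = s + s := by rw [pow_succ, mul_two]
    have hd := (degree_add_le _ _).trans_lt (max_lt hd₀ hd₁)
    refine ⟨_, by rw [h2s]; exact hd, fun l hl => ?_, ?_⟩
    · rw [h2s, Set.mem_Ico] at hl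
      rw [eval_add]
      by_cases hl' : l < a + s
      · rw [h₀ l ⟨hl.1, hl'⟩, h₁' l ⟨hl.1, hl'⟩, add_zero]
      · rw [h₀' l ⟨by omega, by omega⟩, h₁ l ⟨by omega, by omega⟩, zero_add]
    · have hsub : ∀ b, a ≤ b → b ≤ a + s → v '' Set.Ico b (b + s) ⊆
          v '' Set.Ico a (a + 2 ^ (j + 1)) ∪ constFuns K E := by
        intro b hb hb'
        refine (Set.image_mono fun l hl => ?_).trans Set.subset_union_left
        rw [Set.mem_Ico] at hl ⊢
        omega
      refine ((((hc₀.mono_left (hsub a le_rfl (by omega))).union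
        (hc₁.mono_left (hsub _ (by omega) le_rfl))).trans
        (CostLe.polyAdd hd (fun _ hx => Or.inl (Or.inr (Or.inl hx)))
          fun _ hx => Or.inl (Or.inr (Or.inr hx)))).mono_cost
        (le_trans ?_ (two_pow_step hsup hle j)))
      linarith

end Polynomials

/-! ### The action of `K[X]⟨θ⟩` on polynomials -/

namespace ThetaAlgebra

open Polynomial

variable (K : Type*) [Field K]

/-- The action of the generators on `K[X]`: multiplication by `X`, and `X d/dX`. -/
noncomputable def genAction : ThetaGen → Module.End K K[X]
  | .X => LinearMap.mulLeft K Polynomial.X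
  | .theta => LinearMap.mulLeft K Polynomial.X ∘ₗ derivative

/-- The action of `K[X]⟨θ⟩` on `K[X]`. -/
noncomputable def action : ThetaAlgebra K →ₐ[K] Module.End K K[X] :=
  RingQuot.liftAlgHom K ⟨FreeAlgebra.lift K (genAction K), by
    rintro _ _ ⟨⟩
    -- The relation is the Leibniz rule X (X f)' = X (X f' + f).
    refine LinearMap.ext fun f => ?_
    simp [genAction]
    ring⟩

theorem action_X (f : K[X]) : action K (X K) f = Polynomial.X * f := by
  simp [action, X, genAction]

theorem action_theta (f : K[X]) : action K (theta K) f = Polynomial.X * derivative f := by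
  simp [action, theta, genAction]

theorem action_X_pow (i : ℕ) (f : K[X]) : action K (X K ^ i) f = Polynomial.X ^ i * f := by
  induction i with
  | zero => simp
  | succ i ih => rw [pow_succ', map_mul, Module.End.mul_apply, ih, action_X, pow_succ', mul_assoc]

/-- Monomials are eigenvectors of X d/dX, so a coefficient polynomial in θ acts on X^l through its
value at l. -/
theorem action_theta_pow_X_pow (j l : ℕ) :
    action K (theta K ^ j) (Polynomial.X ^ l) = C ((l : K) ^ j) * Polynomial.X ^ l := by
  induction j with
  | zero => simp
  | succ j ih =>
    rw [pow_succ', map_mul, Module.End.mul_apply, ih, action_theta, derivative_C_mul,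
      derivative_X_pow, pow_succ', C_mul]
    rcases l with _ | l
    · simp
    · rw [Nat.add_sub_cancel, pow_succ (Polynomial.X : K[X]) l]
      ring

variable {K}

theorem action_ofCoeffs_X_pow {d r : ℕ} (a : Fin (d + 1) × Fin (r + 1) → K) (l : ℕ) :
    action K (ofCoeffs a) (Polynomial.X ^ l) =
      ∑ i : Fin (d + 1), monomial (i + l) (∑ j : Fin (r + 1), a (i, j) * (l : K) ^ (j : ℕ)) := by
  simp only [ofCoeffs, map_sum, LinearMap.sum_apply, map_smul, map_mul, Module.End.mul_apply,
    LinearMap.smul_apply, action_theta_pow_X_pow, action_X_pow]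
  refine Finset.sum_congr rfl fun i _ => Finset.sum_congr rfl fun j _ => ?_
  rw [← C_mul_X_pow_eq_monomial, smul_eq_C_mul, C_mul, pow_add]
  ring

theorem coeff_action_ofCoeffs {d r : ℕ} (a : Fin (d + 1) × Fin (r + 1) → K) (l s : ℕ) :
    (action K (ofCoeffs a) (Polynomial.X ^ l)).coeff (s + l) =
      if h : s < d + 1 then ∑ j : Fin (r + 1), a (⟨s, h⟩, j) * (l : K) ^ (j : ℕ) else 0 := by
  rw [action_ofCoeffs_X_pow]
  simp only [finsetSum_coeff, coeff_monomial, add_left_inj]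
  split
  · rename_i h
    rw [Finset.sum_eq_single ⟨s, h⟩]
    · simp
    · intro b _ hb
      rw [if_neg]
      rintro rfl
      exact hb rfl
    · simp
  · rename_i h
    refine Finset.sum_eq_zero fun i _ => if_neg ?_
    have := i.2
    omega

theorem coeff_action_mul {d r : ℕ} (a b : Fin (d + 1) × Fin (r + 1) → K) (l s : ℕ) :
    (action K (ofCoeffs a * ofCoeffs b) (Polynomial.X ^ l)).coeff (s + l) =
      ∑ i : Fin (d + 1), if (i : ℕ) ≤ s then
        (action K (ofCoeffs a) (Polynomial.X ^ (i + l))).coeff (s - i + (i + l)) *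
        ∑ j : Fin (r + 1), b (i, j) * (l : K) ^ (j : ℕ) else 0 := by
  rw [map_mul, Module.End.mul_apply, action_ofCoeffs_X_pow, map_sum, finsetSum_coeff]
  refine Finset.sum_congr rfl fun i _ => ?_
  rw [← C_mul_X_pow_eq_monomial, ← smul_eq_C_mul, map_smul, coeff_smul, smul_eq_mul]
  split
  · rw [mul_comm, show s - (i : ℕ) + (i + l) = s + l by omega]
  -- For i > s the image of X^(i+l) only involves exponents at least i + l > s + l.
  · rw [action_ofCoeffs_X_pow, finsetSum_coeff]
    refine mul_eq_zero_of_right _ (Finset.sum_eq_zero fun k _ => ?_)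
    rw [coeff_monomial, if_neg (by omega)]

end ThetaAlgebra

-- θ annihilates 1, so the constant term of the image of 1 under the product is the product of the
-- two coefficients of index (0, 0).
open Polynomial in
theorem SolvableIn.thetaMul_pos {K : Type*} [Field K] [CharZero K] {d r k : ℕ}
    (h : SolvableIn (thetaMulProblem K d r) k) : 0 < k := by
  refine h.pos_of_sq (⟨0, by omega⟩, ⟨0, by omega⟩) fun u y hy => ?_
  have h₁ := congrArg (fun L => (ThetaAlgebra.action K L (X ^ 0)).coeff (0 + 0)) hy
  simp only [ThetaAlgebra.coeff_action_mul, ThetaAlgebra.coeff_action_ofCoeffs] at h₁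
  simpa [zero_pow_eq, Fin.sum_univ_succ] using h₁

open Polynomial in
/-- The product of two operators `∑ X ^ i a_i(θ)` and `∑ X ^ i b_i(θ)`, seen through the values of
its coefficients at natural numbers. -/
theorem CostLe.exists_thetaMul {K : Type*} [Field K] {E : Type*} {n k : ℕ}
    (h : SolvableIn (thetaMulProblem K n n) k) {a b : ℕ → (E → K)[X]}
    (ha : ∀ i, (a i).natDegree ≤ n) (hb : ∀ i, (b i).natDegree ≤ n)
    (ha' : ∀ i, n < i → a i = 0) (hb' : ∀ i, n < i → b i = 0) :
    ∃ c : ℕ → (E → K)[X], (∀ s, (c s).degree < ((2 * n + 1 : ℕ) : WithBot ℕ)) ∧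
      CostLe (⋃ i ∈ Finset.range (n + 1), (coeffSet (a i) ∪ coeffSet (b i)))
        (⋃ s, coeffSet (c s)) k ∧
      ∀ s ≤ 2 * n, ∀ l : ℕ, (c s).eval (algebraMap K (E → K) l) =
        ∑ i ∈ Finset.range (s + 1), (a (s - i)).eval (algebraMap K (E → K) ((i + l : ℕ) : K)) *
          (b i).eval (algebraMap K (E → K) l) := by
  obtain ⟨y, hy, hP⟩ := h.exists_costLe
    (Sum.elim (fun i : Fin (n + 1) × Fin (n + 1) => (a i.1).coeff i.2)
      fun i : Fin (n + 1) × Fin (n + 1) => (b i.1).coeff i.2)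
  set c : ℕ → (E → K)[X] := fun s => ∑ j : Fin (2 * n + 1),
    monomial j (if h : s < 2 * n + 1 then y (⟨s, h⟩, j) else 0) with hc
  have hev : ∀ (f : (E → K)[X]) (e : E), f.natDegree ≤ n → ∀ t : K,
      f.eval (algebraMap K (E → K) t) e = ∑ j : Fin (n + 1), f.coeff j e * t ^ (j : ℕ) := by
    intro f e hf t
    rw [eval_eq_sum_range' (n := n + 1) (by omega), Finset.sum_apply, Finset.sum_range]
    rfl
  refine ⟨c, fun s => ?_, ?_, fun s hs l => ?_⟩
  · rw [degree_lt_iff_coeff_zero]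
    intro i hi
    simp only [hc, finsetSum_coeff, coeff_monomial]
    refine Finset.sum_eq_zero fun j _ => if_neg ?_
    have := j.2
    omega
  · refine hy.mono ?_ ?_ le_rfl
    · rintro _ ⟨i | i, rfl⟩
      · exact Or.inl (Set.mem_biUnion (Finset.mem_coe.mpr (Finset.mem_range.mpr i.1.2))
          (Or.inl ⟨i.2, rfl⟩))
      · exact Or.inl (Set.mem_biUnion (Finset.mem_coe.mpr (Finset.mem_range.mpr i.1.2))
          (Or.inr ⟨i.2, rfl⟩))
    · refine Set.iUnion_subset fun s => ?_
      rintro _ ⟨i, rfl⟩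
      simp only [hc, finsetSum_coeff, coeff_monomial]
      by_cases hi : i < 2 * n + 1
      · rw [Finset.sum_eq_single ⟨i, hi⟩]
        · simp only [if_true]
          split
          exacts [Or.inl ⟨_, rfl⟩, Or.inr (Or.inr ⟨0, map_zero _⟩)]
        · intro j _ hj
          rw [if_neg]
          rintro rfl
          exact hj rfl
        · simp
      · rw [Finset.sum_eq_zero]
        · exact Or.inr (Or.inr ⟨0, map_zero _⟩)
        · intro j _
          rw [if_neg]
          have := j.2
          omega
  · funext e
    -- Both sides are applied to X^l and the coefficients of X^(s+l) compared. The action alone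
    -- determines the values needed, so uniqueness of canonical forms plays no role.
    have h₁ := congrArg (fun L => (ThetaAlgebra.action K L (X ^ l)).coeff (s + l)) (hP e)
    simp only [ThetaAlgebra.coeff_action_mul, ThetaAlgebra.coeff_action_ofCoeffs, Sum.elim_inl,
      Sum.elim_inr, dif_pos (Nat.lt_succ_of_le hs)] at h₁
    have hcs : (c s).eval (algebraMap K (E → K) l) e =
        ∑ j : Fin (2 * n + 1), y (⟨s, by omega⟩, j) e * (l : K) ^ (j : ℕ) := by
      simp only [hc, eval_finsetSum, eval_monomial, dif_pos (Nat.lt_succ_of_le hs),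
        Finset.sum_apply]
      rfl
    have hA : ∀ i t : ℕ, (if h : i < n + 1 then ∑ j : Fin (n + 1),
        (a i).coeff j e * (t : K) ^ (j : ℕ) else 0) =
          (a i).eval (algebraMap K (E → K) (t : K)) e := by
      intro i t
      split
      · rw [hev _ e (ha i)]
      · rw [ha' i (by omega), eval_zero, Pi.zero_apply]
    rw [hcs, h₁, Finset.sum_apply]
    simp only [hA, ← hev _ e (hb _)]
    rw [← Finset.sum_range (n := n + 1) fun i => if i ≤ s then
      (a (s - i)).eval (algebraMap K (E → K) ((i + l : ℕ) : K)) e *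
        (b i).eval (algebraMap K (E → K) (l : K)) e else 0, ← Finset.sum_filter]
    -- The two index ranges differ only by indices i > n, where b_i = 0.
    refine Finset.sum_subset_zero_on_sdiff ?_ ?_ fun i _ => rfl
    · intro i
      simp only [Finset.mem_filter, Finset.mem_range]
      omega
    · intro i
      simp only [Finset.mem_sdiff, Finset.mem_filter, Finset.mem_range]
      intro hi
      rw [hb' i (by omega), eval_zero, mul_zero, Pi.zero_apply]

/-! ### Matrices -/

section Matrices

open Polynomial

variable {K : Type*} [Field K] {E : Type*}

/-- The set of the entries of a matrix. -/
def entrySet {ι κ : Type*} (X : Matrix ι κ (E → K)) : Set (E → K) :=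
  Set.range fun p : ι × κ => X p.1 p.2

/-- Matrices whose entries are functions of the input can be multiplied in `k` operations. -/
def MatMulCostLe (K : Type*) [Field K] (E : Type*) (ι : Type*) [Fintype ι] (k : ℕ) : Prop :=
  ∀ X Y : Matrix ι ι (E → K), CostLe (entrySet X ∪ entrySet Y) (entrySet (X * Y)) k

theorem MatMulCostLe.solvableIn {n k : ℕ}
    (h : MatMulCostLe K ((Fin n × Fin n) ⊕ (Fin n × Fin n) → K) (Fin n) k) :
    SolvableIn (matMulProblem K n n n) k := by
  have h₁ := h (Matrix.of fun i j e => e (Sum.inl (i, j)))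
    (Matrix.of fun i j e => e (Sum.inr (i, j)))
  refine solvableIn_of_costLe _ (h₁.mono_left ?_) fun e => ?_
  · rintro _ (⟨p, rfl⟩ | ⟨p, rfl⟩)
    exacts [Or.inl ⟨Sum.inl p, rfl⟩, Or.inl ⟨Sum.inr p, rfl⟩]
  · ext i j
    simp [Matrix.mul_apply]

theorem MatMulCostLe.naive (ι : Type*) [Fintype ι] :
    MatMulCostLe K E ι (Fintype.card ι ^ 2 * (2 * Fintype.card ι)) := by
  intro X Y
  refine (CostLe.range (k := Fintype.card ι * 1 + Fintype.card ι) fun p => ?_).mono_cost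
    (le_of_eq ?_)
  · rw [Matrix.mul_apply]
    refine (CostLe.range (T := fun j => X p.1 j * Y j p.2) fun j => CostLe.mul
      (Or.inl (Or.inl ⟨(p.1, j), rfl⟩)) (Or.inl (Or.inr ⟨(j, p.2), rfl⟩))).trans
      (CostLe.sum Finset.univ fun j _ => Or.inl (Or.inr ⟨j, rfl⟩))
  · rw [Fintype.card_prod]
    ring

/-- Multiplication of matrices cut into blocks. -/
theorem MatMulCostLe.prod {ι : Type*} [Fintype ι] {k : ℕ} (h : MatMulCostLe K E ι k) (β : Type*)
    [Fintype β] : MatMulCostLe K E (β × ι)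
      (Fintype.card β ^ 3 * k + Fintype.card β ^ 3 * Fintype.card ι ^ 2) := by
  intro X Y
  have h₁ : CostLe (entrySet X ∪ entrySet Y) (⋃ t : β × β × β,
      entrySet (X.submatrix (Prod.mk t.1) (Prod.mk t.2.1) *
        Y.submatrix (Prod.mk t.2.1) (Prod.mk t.2.2))) (Fintype.card (β × β × β) * k) := by
    refine CostLe.iUnion fun t => (h _ _).mono_left ?_
    rintro _ (⟨p, rfl⟩ | ⟨p, rfl⟩)
    exacts [Or.inl (Or.inl ⟨((t.1, p.1), (t.2.1, p.2)), rfl⟩),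
      Or.inl (Or.inr ⟨((t.2.1, p.1), (t.2.2, p.2)), rfl⟩)]
  refine (h₁.trans (CostLe.range (k := Fintype.card β) fun p => ?_)).mono_cost (le_of_eq ?_)
  · rw [Matrix.mul_apply, Fintype.sum_prod_type]
    refine CostLe.sum Finset.univ fun c _ => Or.inl (Or.inr ?_)
    exact Set.mem_iUnion.mpr ⟨(p.1.1, c, p.2.1), ⟨(p.1.2, p.2.2), by
      simp [Matrix.mul_apply]⟩⟩
  · simp only [Fintype.card_prod]
    ring

/-- Multiplication of matrices padded with zeros. -/
theorem MatMulCostLe.of_injective {ι κ : Type*} [Fintype ι] [Fintype κ] {k : ℕ}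
    (h : MatMulCostLe K E ι k) {f : κ → ι} (hf : Function.Injective f) : MatMulCostLe K E κ k := by
  classical
  intro X Y
  let pad : Matrix κ κ (E → K) → Matrix ι ι (E → K) := fun Z => Matrix.of fun i j =>
    if h : (∃ i', f i' = i) ∧ ∃ j', f j' = j then Z h.1.choose h.2.choose else 0
  have hpad : ∀ Z i j, pad Z (f i) (f j) = Z i j := by
    intro Z i j
    have h' : (∃ i', f i' = f i) ∧ ∃ j', f j' = f j := ⟨⟨i, rfl⟩, ⟨j, rfl⟩⟩
    simp only [pad, Matrix.of_apply, dif_pos h']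
    rw [hf h'.1.choose_spec, hf h'.2.choose_spec]
  have hpad₀ : ∀ Z i j, (¬ ∃ j', f j' = j) → pad Z i j = 0 := by
    intro Z i j hj
    simp only [pad, Matrix.of_apply]
    exact dif_neg fun h => hj h.2
  have hsub : ∀ Z, entrySet (pad Z) ⊆ entrySet Z ∪ constFuns K E := by
    rintro Z _ ⟨p, rfl⟩
    simp only [pad, Matrix.of_apply]
    split
    exacts [Or.inl ⟨(_, _), rfl⟩, Or.inr ⟨0, map_zero _⟩]
  refine (h (pad X) (pad Y)).mono ?_ ?_ le_rfl
  · exact Set.union_subset ((hsub X).trans (Set.union_subset_union_left _ Set.subset_union_left))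
      ((hsub Y).trans (Set.union_subset_union_left _ Set.subset_union_right))
  · rintro _ ⟨p, rfl⟩
    refine Or.inl ⟨(f p.1, f p.2), ?_⟩
    simp only [Matrix.mul_apply]
    refine (Finset.sum_of_injOn f hf.injOn (by simp) ?_ fun j _ => ?_).symm
    · intro j _ hj
      rw [hpad₀ X _ j (by simpa using hj), zero_mul]
    · rw [hpad, hpad]

/-- Multiplication of matrices as a product of operators. -/
theorem MatMulCostLe.of_thetaMul [CharZero K] {M : ℕ → ℕ}
    (hM : ∀ n, SolvableIn (polyMulProblem K n) (M n))
    (hsup : ∀ m n, 0 < m → 0 < n → M m + M n ≤ M (m + n)) {n j k : ℕ}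
    (h : SolvableIn (thetaMulProblem K n n) k) (hj : 2 * 2 ^ j ≤ n) (hn : n < 4 * 2 ^ j) :
    MatMulCostLe K E (Fin (2 ^ j)) (2 * 2 ^ j * (2 * (4 * j * M (2 ^ j))) + k +
      (2 * n + 1) * (8 * (4 * j * M (2 ^ j) + 2 * 2 ^ j))) := by
  have hle := SolvableIn.le_polyMul hM hsup
  set m := 2 ^ j with hm
  intro X Y
  set φ := algebraMap K (E → K)
  have hp : Function.Injective (Nat.cast : ℕ → K) := Nat.cast_injective
  let ext : Matrix (Fin m) (Fin m) (E → K) → ℕ → ℕ → E → K := fun Z r c =>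
    if h : r < m ∧ c < m then Z ⟨r, h.1⟩ ⟨c, h.2⟩ else 0
  have hext : ∀ Z r c, ext Z r c ∈ entrySet Z ∪ constFuns K E := by
    intro Z r c
    simp only [ext]
    split
    exacts [Or.inl ⟨(_, _), rfl⟩, Or.inr ⟨0, map_zero _⟩]
  have hext₀ : ∀ Z r c, m ≤ r → ext Z r c = 0 := fun Z r c h => dif_neg (by omega)
  -- Prescribed values of a_d on [m, 2m) and of b_d on [0, m): A sends X^(m+q) to column q of the
  -- first matrix, placed at exponents 2m + i, and B sends X^l to column l of the second, placed at
  -- exponents m + q. The conditions prevent truncated subtraction from producing a spurious row 0.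
  let v : ℕ → ℕ → E → K := fun d l => if 2 * m ≤ d + l then ext X (d + l - 2 * m) (l - m) else 0
  let w : ℕ → ℕ → E → K := fun d l => if m ≤ d + l then ext Y (d + l - m) l else 0
  choose a₀ ha₀ hav hac using fun d => exists_costLe_interpolate hM hsup hle hp j m (v d)
  choose b₀ hb₀ hbw hbc using fun d => exists_costLe_interpolate hM hsup hle hp j 0 (w d)
  let a : ℕ → (E → K)[X] := fun d => if d < 2 * m then a₀ d else 0
  let b : ℕ → (E → K)[X] := fun d => if d < 2 * m then b₀ d else 0
  have hdeg : ∀ {f : (E → K)[X]}, f.degree < (m : WithBot ℕ) → f.natDegree ≤ n := fun hf =>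
    (natDegree_le_of_degree_lt hf).trans (by omega)
  obtain ⟨c, hcdeg, hc, hceval⟩ := CostLe.exists_thetaMul h (a := a) (b := b)
    (fun i => by
      simp only [a]
      split
      exacts [hdeg (ha₀ i), by simp])
    (fun i => by
      simp only [b]
      split
      exacts [hdeg (hb₀ i), by simp])
    (fun i hi => if_neg (by omega)) fun i hi => if_neg (by omega)
  have c₁ : CostLe (entrySet X ∪ entrySet Y)
      (⋃ d ∈ Finset.range (2 * m), (coeffSet (a₀ d) ∪ coeffSet (b₀ d)))
      (2 * m * (2 * (4 * j * M m))) := by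
    refine (CostLe.biUnion (k := 4 * j * M m + 4 * j * M m) (Finset.range (2 * m)) fun d _ =>
      ((hac d).mono_left ?_).union ((hbc d).mono_left ?_)).mono_cost (le_of_eq ?_)
    · rintro _ ⟨l, -, rfl⟩
      simp only [v]
      split
      · exact Set.union_subset_union_left _ Set.subset_union_left (hext X _ _)
      · exact Or.inr ⟨0, map_zero _⟩
    · rintro _ ⟨l, -, rfl⟩
      simp only [w]
      split
      · exact Set.union_subset_union_left _ Set.subset_union_right (hext Y _ _)
      · exact Or.inr ⟨0, map_zero _⟩
    · rw [Finset.card_range]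
      ring
  have c₂ : CostLe (⋃ d ∈ Finset.range (2 * m), (coeffSet (a₀ d) ∪ coeffSet (b₀ d)))
      (⋃ s, coeffSet (c s)) k := by
    refine hc.mono_left (Set.iUnion₂_subset fun d _ => ?_)
    by_cases hd : d < 2 * m
    · simp only [a, b, if_pos hd]
      exact fun x hx => Or.inl (Set.mem_biUnion (by simpa using hd) hx)
    · simp only [a, b, if_neg hd]
      rintro _ (⟨i, rfl⟩ | ⟨i, rfl⟩) <;> exact Or.inr ⟨0, by simp⟩
  have c₃ : CostLe (⋃ s, coeffSet (c s)) (⋃ s ∈ Finset.range (2 * n + 1),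
      (fun l : ℕ => (c s).eval (φ (l : K))) '' Set.Ico 0 (0 + m))
      ((2 * n + 1) * (8 * (4 * j * M m + 2 * m))) := by
    -- Eight pieces of length m suffice, since n < 4m gives 2n + 1 ≤ 8m.
    refine (CostLe.biUnion (Finset.range (2 * n + 1)) fun s _ =>
      (CostLe.multipointEval_of_degree_lt_mul hM hsup hle Nat.cast j 0 8 (c s)
        ((hcdeg s).trans_le (WithBot.coe_le_coe.mpr ?_))).mono_left
        fun x hx => Or.inl (Set.mem_iUnion.mpr ⟨s, hx⟩)).mono_cost (by rw [Finset.card_range])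
    show 2 * n + 1 ≤ 8 * 2 ^ j
    omega
  refine ((c₁.trans (c₂.mono_left fun _ hx => Or.inl (Or.inr hx))).trans
    (c₃.mono_left fun _ hx => Or.inl (Or.inr hx))).weaken ?_ le_rfl
  rintro _ ⟨⟨i, l⟩, rfl⟩
  have hi := i.2
  have hl := l.2
  -- Entry (i, l) is the coefficient of X^(2m+i) in the image of X^l, hence the value at l of the
  -- coefficient of index 2m + i - l.
  refine Set.mem_biUnion (x := 2 * m + i - l) (by simp; omega) ⟨l, by simp, ?_⟩
  simp only
  rw [hceval _ (by omega), Matrix.mul_apply]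
  have hbval : ∀ r, (b r).eval (φ ((l : ℕ) : K)) =
      if m ≤ r + l then ext Y (r + l - m) l else 0 := by
    intro r
    simp only [b]
    split
    · exact hbw r l (by simp [← hm])
    -- Cutting b at 2m loses nothing: for r ≥ 2m the row r + l - m lies outside the matrix.
    · rw [eval_zero, if_pos (by omega), hext₀ _ _ _ (by omega)]
  -- The intermediate exponent r + l must be m + q with q < m; every other r contributes zero
  -- through b_r(l).
  refine (Finset.sum_of_injOn (fun q : Fin m => m + q - l) ?_ ?_ ?_ fun q _ => ?_).symm
  · intro q _ q' _ hq
    have h' : m + (q : ℕ) - l = m + q' - l := hq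
    exact Fin.ext (by omega)
  · intro q _
    have := q.2
    simp only [Finset.coe_range, Set.mem_Iio]
    omega
  · intro r _ hr
    rw [hbval, mul_eq_zero_of_right]
    split
    · by_cases h' : r + l - m < m
      · exact absurd ⟨⟨r + l - m, h'⟩, by simp, by simp only; omega⟩ hr
      · exact hext₀ _ _ _ (by omega)
    · rfl
  · have hq := q.2
    rw [hbval, if_pos (by omega)]
    have h₁ : 2 * m + i - l - (m + q - l) = m + i - q := by omega
    have h₂ : m + (q : ℕ) - l + l = m + q := by omega
    rw [h₁, h₂]
    simp only [a, if_pos (show m + (i : ℕ) - q < 2 * m by omega)]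
    rw [hav _ _ (by simp [← hm])]
    simp only [v]
    rw [if_pos (by omega)]
    have h₃ : m + (i : ℕ) - q + (m + q) - 2 * m = i := by omega
    rw [h₃]
    simp [ext]

end Matrices

/-! ### Bounds for MM(n). -/

theorem matMulCost_le {K : Type*} [Field K] {n k : ℕ} (h : SolvableIn (matMulProblem K n n n) k) :
    matMulCost K n ≤ k :=
  Nat.sInf_le h

theorem matMulCost_zero (K : Type*) [Field K] : matMulCost K 0 = 0 :=
  Nat.le_zero.mp (matMulCost_le (by simpa using (MatMulCostLe.naive (K := K) (Fin 0)).solvableIn))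

theorem matMulCost_le_of_thetaMul {K : Type*} [Field K] [CharZero K] {M : ℕ → ℕ}
    (hM : ∀ n, SolvableIn (polyMulProblem K n) (M n))
    (hsup : ∀ m n, 0 < m → 0 < n → M m + M n ≤ M (m + n)) {n k : ℕ}
    (h : SolvableIn (thetaMulProblem K n n) k) (hn : 2 ≤ n) :
    matMulCost K n ≤ 64 * (k + 300 * (n * M n * Nat.log 2 n)) := by
  obtain ⟨j, hj⟩ : ∃ j, Nat.log 2 n = j + 1 :=
    ⟨Nat.log 2 n - 1, by have := Nat.log_pos one_lt_two hn; omega⟩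
  have h₁ : 2 * 2 ^ j ≤ n := by
    rw [← pow_succ', ← hj]
    exact Nat.pow_log_le_self 2 (by omega)
  have h₂ : n < 4 * 2 ^ j := by
    have := Nat.lt_pow_succ_log_self one_lt_two n
    rw [hj, pow_succ, pow_succ] at this
    omega
  -- Since n < 4 · 2^j, an n × n matrix fits into 4 × 4 blocks of size 2^j, whence the factor 64 =
  -- 4^3.
  have h₃ := (((MatMulCostLe.of_thetaMul (E := (Fin n × Fin n) ⊕ (Fin n × Fin n) → K) hM hsup h h₁
    h₂).prod (Fin 4)).of_injective (f := fun i : Fin n =>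
      finProdFinEquiv.symm (Fin.castLE h₂.le i)) fun x y hxy =>
        Fin.castLE_injective _ (finProdFinEquiv.symm.injective hxy)).solvableIn
  refine (matMulCost_le h₃).trans ?_
  have h₄ : M (2 ^ j) ≤ M n := le_of_superadditive hsup (by positivity) (by omega)
  have h₅ : n ≤ M n := SolvableIn.le_polyMul hM hsup n
  rw [hj, Fintype.card_fin, Fintype.card_fin]
  generalize 2 ^ j = m at *
  have h₆ : m * (j * M m) ≤ n * (j * M n) :=
    Nat.mul_le_mul (by omega) (Nat.mul_le_mul_left _ h₄)
  have h₇ : n * (j * M m) ≤ n * (j * M n) := Nat.mul_le_mul_left _ (Nat.mul_le_mul_left _ h₄)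
  have h₈ : n * m ≤ n * M n := Nat.mul_le_mul_left _ (by omega)
  have h₉ : m * m ≤ n * M n := Nat.mul_le_mul (by omega) (by omega)
  have h₁₀ : j * M m ≤ n * (j * M m) := Nat.le_mul_of_pos_left _ (by omega)
  have h₁₁ : m ≤ n * m := Nat.le_mul_of_pos_left _ (by omega)
  -- Besides k, each block product is charged at most 112 n j M(n) + 49 n M(n), including its share
  -- of the block additions; 300 n M(n) (j + 1) leaves ample room.
  nlinarith

theorem mainTheorem1 (K : Type*) [Field K] [CharZero K] (Cθ M : ℕ → ℕ)
    (hCθ : ∀ n, SolvableIn (thetaMulProblem K n n) (Cθ n))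
    (hM : ∀ n, SolvableIn (polyMulProblem K n) (M n))
    (hM_superlinear : ∀ m n, 0 < m → 0 < n → M m + M n ≤ M (m + n))
    (hM_dilation : ∀ c, 0 < c → (fun n => (M (c * n) : ℝ)) =O[atTop] (fun n => (M n : ℝ))) :
    ∃ κ : ℝ, 0 < κ ∧ ∀ n : ℕ,
      SolvableIn (matMulProblem K n n n) (matMulCost K n) ∧
      (matMulCost K n : ℝ) ≤ κ * ((Cθ n : ℝ) + (n : ℝ) * (M n : ℝ) * Real.log (n : ℝ)) := by
  have hlog : 0 < Real.log 2 := Real.log_pos one_lt_two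
  -- The division by log 2 turns the binary logarithm into the natural one.
  refine ⟨64 * (1 + 300 / Real.log 2), by positivity, fun n =>
    ⟨Nat.sInf_mem (s := {k | SolvableIn (matMulProblem K n n n) k})
      ⟨_, (MatMulCostLe.naive (Fin n)).solvableIn⟩, ?_⟩⟩
  rcases Nat.lt_or_ge n 2 with hn | hn
  · obtain rfl | rfl : n = 0 ∨ n = 1 := by omega
    · rw [matMulCost_zero]
      simp only [Nat.cast_zero, zero_mul, add_zero]
      positivity
    -- For n = 1 the logarithm vanishes, so the bound must come from Cθ(1) ≥ 1.
    · have h₁ : matMulCost K 1 ≤ 2 :=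
        matMulCost_le (by simpa using (MatMulCostLe.naive (K := K) (Fin 1)).solvableIn)
      have h₂ : (1 : ℝ) ≤ Cθ 1 := by exact_mod_cast (hCθ 1).thetaMul_pos
      have h₃ : (matMulCost K 1 : ℝ) ≤ 2 := by exact_mod_cast h₁
      have h₄ : 0 ≤ 300 / Real.log 2 := by positivity
      simp only [Nat.cast_one, Real.log_one, mul_zero, add_zero]
      nlinarith
  · have h₁ : (matMulCost K n : ℝ) ≤ 64 * (Cθ n + 300 * (n * M n * (Nat.log 2 n : ℕ))) := by
      exact_mod_cast matMulCost_le_of_thetaMul hM hM_superlinear (hCθ n) hn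
    have h₂ : (Nat.log 2 n : ℝ) * Real.log 2 ≤ Real.log n := by
      rw [← Real.log_pow]
      refine Real.log_le_log (by positivity) ?_
      exact_mod_cast Nat.pow_log_le_self 2 (by omega)
    have h₃ : (Nat.log 2 n : ℝ) ≤ Real.log n / Real.log 2 := (le_div_iff₀ hlog).mpr h₂
    have h₄ : 0 ≤ Real.log n := Real.log_natCast_nonneg n
    calc (matMulCost K n : ℝ) ≤ 64 * (Cθ n + 300 * (n * M n * (Nat.log 2 n : ℕ))) := h₁
      _ ≤ 64 * (Cθ n + 300 * (n * M n * (Real.log n / Real.log 2))) := by gcongr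
      _ = 64 * (1 * Cθ n + 300 / Real.log 2 * (n * M n * Real.log n)) := by ring
      _ ≤ 64 * ((1 + 300 / Real.log 2) * Cθ n +
          (1 + 300 / Real.log 2) * (n * M n * Real.log n)) := by
        gcongr
        · exact le_add_of_nonneg_right (by positivity)
        · exact le_add_of_nonneg_left zero_le_one
      _ = _ := by ring
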